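/- Let $E$ be a Riesz space (real vector lattice), and let $E^\delta$ be a Dedekind completion of $E$ (one exists exactly when $E$ is Archimedean), that is, a Dedekind complete Riesz space containing $E$, via a linear lattice embedding, as an order dense and majorizing Riesz subspace. In a Riesz space, write $u\perp v$ if $|u|\wedge|v|=0$, and $y\sqsubseteq z$ ($y$ is a fragment of $z$) if $y\perp(z-y)$. A net $(x_\alpha)$ order converges to $x$ if there is a net $(y_\beta)$, possibly over a different index set, with $y_\beta\downarrow 0$ such that for every $\beta$ there is $\alpha_0$ with $|x_\alpha-x|\le y_\beta$ for all $\alpha\ge\alpha_0$. It laterally converges to $x$ if $x_\alpha\sqsubseteq x_\beta\sqsubseteq x$ for all indices $\alpha<\beta$ and $(x_\alpha)$ order converges to $x$. Then for every net $(x_\alpha)$ in $E$ and every $x\in E$, $(x_\alpha)$ laterally converges to $x$ in $E$ if and only if $(x_\alpha)$ laterally converges to $x$ in $E^\delta$. -/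

import Mathlib

/-! Riesz spaces (real vector lattices) are real modules `E` with
`[AddCommGroup E] [Lattice E] [IsOrderedAddMonoid E] [Module ℝ E] [IsOrderedModule ℝ E]`. -/

namespace RieszSpace

universe u v w

/-- Disjointness `x ⊥ y` of two elements: `|x| ∧ |y| = 0`. -/
def IsDisjoint {E : Type u} [AddCommGroup E] [Lattice E] (x y : E) : Prop :=
  |x| ⊓ |y| = 0

/-- `y` is a fragment of `x`: `y ⊥ (x - y)`. -/
def IsFragment {E : Type u} [AddCommGroup E] [Lattice E] (y x : E) : Prop :=
  IsDisjoint y (x - y)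

/-- The net `(x α)` order converges to `l`: there is a net `(y β)` decreasing to `0` (over a
possibly different directed set) such that each `y β` eventually dominates `|x α - l|`.
Index sets `B` in the universe of `E` suffice, since the decreasing net `y` may always be replaced
by the identity net on its range, directed by `≥`. -/
def OrderConverges {E : Type u} [AddCommGroup E] [Lattice E] {A : Type w} [Preorder A]
    (x : A → E) (l : E) : Prop :=
  ∃ (B : Type u) (_ : Preorder B) (_ : IsDirectedOrder B) (_ : Nonempty B) (y : B → E),
    Antitone y ∧ IsGLB (Set.range y) 0 ∧
      ∀ β : B, ∃ α₀ : A, ∀ α : A, α₀ ≤ α → |x α - l| ≤ y β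

/-- The net `(x α)` laterally converges to `l`: `x α ⊑ x β ⊑ l` for all indices `α < β`, and
`(x α)` order converges to `l`. -/
def LaterallyConverges {E : Type u} [AddCommGroup E] [Lattice E] {A : Type w} [Preorder A]
    (x : A → E) (l : E) : Prop :=
  (∀ α β : A, α < β → IsFragment (x α) (x β) ∧ IsFragment (x β) l) ∧ OrderConverges x l

/-- Dedekind completeness: every nonempty subset bounded above has a supremum. -/
def IsDedekindComplete (F : Type v) [Lattice F] : Prop :=
  ∀ s : Set F, s.Nonempty → BddAbove s → ∃ a : F, IsLUB s a

/-- `F`, with the embedding `ι : E → F`, is a Dedekind completion of the Riesz space `E`: `F` is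
Dedekind complete and `ι` is a linear lattice isomorphism of `E` onto an order dense, majorizing
Riesz subspace of `F`. -/
structure IsDedekindCompletion {E : Type u} {F : Type v}
    [AddCommGroup E] [Lattice E] [Module ℝ E] [AddCommGroup F] [Lattice F] [Module ℝ F]
    (ι : E →ₗ[ℝ] F) : Prop where
  complete : IsDedekindComplete F
  injective : Function.Injective ι
  map_sup : ∀ x y : E, ι (x ⊔ y) = ι x ⊔ ι y
  map_inf : ∀ x y : E, ι (x ⊓ y) = ι x ⊓ ι y
  orderDense : ∀ y : F, 0 < y → ∃ x : E, 0 < ι x ∧ ι x ≤ y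
  majorizing : ∀ y : F, ∃ x : E, y ≤ ι x

end RieszSpace

namespace RieszSpace

section Lattice

variable {E : Type*} [AddCommGroup E] [Lattice E] [IsOrderedAddMonoid E]

/-! The embedding preserves and reflects fragments, so only order convergence matters. It passes up
because order density preserves infima equal to `0`. It passes down because, along fragments of `l`,
the distances `|x α - l|` decrease (`IsFragment.abs_sub_le_abs_sub`) and so can serve as their own
dominating net in `E`. -/

theorem inf_add_le_inf_add_inf {p q r : E} (hp : 0 ≤ p) (hq : 0 ≤ q) (hr : 0 ≤ r) :
    p ⊓ (q + r) ≤ p ⊓ q + p ⊓ r := by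
  rw [add_inf, inf_add, inf_add]
  refine le_inf (le_inf ?_ ?_) (le_inf ?_ inf_le_right)
  · exact inf_le_left.trans (le_add_of_nonneg_right hp)
  · exact inf_le_left.trans (le_add_of_nonneg_left hq)
  · exact inf_le_left.trans (le_add_of_nonneg_right hr)

/-- Meeting `|b| ≤ |a + b| + |a|` with `|b|` kills the term `|a|`. -/
theorem IsDisjoint.abs_right_le_abs_add {a b : E} (h : IsDisjoint a b) : |b| ≤ |a + b| := by
  have hb : |b| ≤ |a + b| + |a| := by
    have := abs_add_le (a + b) (-a)
    rwa [abs_neg, show a + b + -a = b by abel] at this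
  have h' : |b| ⊓ |a| = 0 := by rw [inf_comm]; exact h
  calc |b| = |b| ⊓ (|a + b| + |a|) := (inf_eq_left.2 hb).symm
    _ ≤ |b| ⊓ |a + b| + |b| ⊓ |a| :=
      inf_add_le_inf_add_inf (abs_nonneg _) (abs_nonneg _) (abs_nonneg _)
    _ ≤ |a + b| := by rw [h', add_zero]; exact inf_le_right

theorem IsDisjoint.mono_left {a b c : E} (h : IsDisjoint a b) (hc : |c| ≤ |a|) :
    IsDisjoint c b :=
  le_antisymm ((inf_le_inf_right _ hc).trans h.le) (le_inf (abs_nonneg _) (abs_nonneg _))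

/-- The distance to `l` decreases along a chain of fragments of `l`. -/
theorem IsFragment.abs_sub_le_abs_sub {a b l : E} (hab : IsFragment a b) (hbl : IsFragment b l) :
    |b - l| ≤ |a - l| := by
  -- Hence `b - a` inherits disjointness from `l - b`, and their sum is `l - a`.
  have hu : |b - a| ≤ |b| := by
    have := IsDisjoint.abs_right_le_abs_add hab
    rwa [add_sub_cancel] at this
  have := IsDisjoint.abs_right_le_abs_add (IsDisjoint.mono_left hbl hu)
  rwa [sub_add_sub_cancel', abs_sub_comm, abs_sub_comm l a] at this

end Lattice

section OrderConvergence

variable {E : Type*} [AddCommGroup E] [Lattice E] {A : Type*} [Preorder A]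

/-- Order convergence may be tested with dominating families indexed in any universe. -/
theorem OrderConverges.of_directed {B : Type*} [Nonempty B] {x : A → E} {l : E} {y : B → E}
    (hdir : Directed (· ≥ ·) y) (hglb : IsGLB (Set.range y) 0)
    (hy : ∀ β, ∃ α₀, ∀ α, α₀ ≤ α → |x α - l| ≤ y β) : OrderConverges x l := by
  -- The range of `y` lives in the universe of `E`, whatever that of `B`.
  refine ⟨(Set.range y)ᵒᵈ, inferInstance, ⟨?_⟩, ?_, fun b => (OrderDual.ofDual b).1,
    fun a b hab => hab, ?_, ?_⟩
  · rintro ⟨_, b, rfl⟩ ⟨_, c, rfl⟩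
    obtain ⟨d, hbd, hcd⟩ := hdir b c
    exact ⟨OrderDual.toDual ⟨y d, d, rfl⟩, hbd, hcd⟩
  · exact ⟨OrderDual.toDual ⟨_, Classical.arbitrary B, rfl⟩⟩
  · convert hglb using 1
    exact Subtype.range_coe
  · rintro ⟨_, b, rfl⟩
    exact hy b

end OrderConvergence

section Completion

variable {E F : Type*} [AddCommGroup E] [Lattice E] [Module ℝ E]
  [AddCommGroup F] [Lattice F] [Module ℝ F] {ι : E →ₗ[ℝ] F}

theorem IsDedekindCompletion.map_le_map_iff (hι : IsDedekindCompletion ι) {a b : E} :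
    ι a ≤ ι b ↔ a ≤ b := by
  rw [← inf_eq_left, ← inf_eq_left, ← hι.map_inf, hι.injective.eq_iff]

theorem IsDedekindCompletion.map_abs (hι : IsDedekindCompletion ι) (a : E) : ι |a| = |ι a| := by
  simp only [abs, hι.map_sup, map_neg]

theorem IsDedekindCompletion.isFragment_map_iff (hι : IsDedekindCompletion ι) {a b : E} :
    IsFragment (ι a) (ι b) ↔ IsFragment a b := by
  unfold IsFragment IsDisjoint
  rw [← map_sub, ← hι.map_abs, ← hι.map_abs, ← hι.map_inf, map_eq_zero_iff ι hι.injective]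

theorem IsDedekindCompletion.isGLB_range_map_zero (hι : IsDedekindCompletion ι) {B : Type*}
    {y : B → E} (hy : IsGLB (Set.range y) 0) : IsGLB (Set.range fun b => ι (y b)) 0 := by
  have h0 : ∀ b, 0 ≤ ι (y b) := fun b => by
    rw [← map_zero ι, hι.map_le_map_iff]
    exact hy.1 ⟨b, rfl⟩
  refine ⟨by rintro _ ⟨b, rfl⟩; exact h0 b, fun f hf => ?_⟩
  by_contra hf0
  -- This `e` is a lower bound of `y` in `E`, hence `e ≤ 0`, against `0 < ι e`.
  obtain ⟨e, he, hef⟩ := hι.orderDense (f ⊔ 0) (right_lt_sup.2 hf0)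
  refine he.not_ge ?_
  rw [← map_zero ι, hι.map_le_map_iff]
  refine hy.2 ?_
  rintro _ ⟨b, rfl⟩
  exact hι.map_le_map_iff.1 (hef.trans (sup_le (hf ⟨b, rfl⟩) (h0 b)))

variable {A : Type*} [Preorder A] {x : A → E} {l : E}

theorem OrderConverges.map (hι : IsDedekindCompletion ι) (h : OrderConverges x l) :
    OrderConverges (fun α => ι (x α)) (ι l) := by
  obtain ⟨B, _, _, _, y, hanti, hglb, hy⟩ := h
  refine .of_directed (y := fun b => ι (y b)) (fun b c => ?_) (hι.isGLB_range_map_zero hglb)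
    fun b => ?_
  · obtain ⟨d, hbd, hcd⟩ := exists_ge_ge b c
    exact ⟨d, hι.map_le_map_iff.2 (hanti hbd), hι.map_le_map_iff.2 (hanti hcd)⟩
  · obtain ⟨α₀, hα₀⟩ := hy b
    refine ⟨α₀, fun α hα => ?_⟩
    rw [← map_sub, ← hι.map_abs, hι.map_le_map_iff]
    exact hα₀ α hα

/-- If the distances `|x α - l|` are eventually dominated by each of their values, then order
convergence in the completion descends to `E`: the distances themselves decrease to `0`. -/
theorem OrderConverges.of_map [IsOrderedAddMonoid E] [IsDirectedOrder A] [Nonempty A]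
    (hι : IsDedekindCompletion ι)
    (hdec : ∀ α, ∃ α₀, ∀ α', α₀ ≤ α' → |x α' - l| ≤ |x α - l|)
    (h : OrderConverges (fun α => ι (x α)) (ι l)) : OrderConverges x l := by
  obtain ⟨B, _, _, _, y, -, hglb, hy⟩ := h
  refine .of_directed (y := fun α => |x α - l|) (fun a b => ?_) ⟨?_, fun e he => ?_⟩ hdec
  · obtain ⟨a₀, ha⟩ := hdec a
    obtain ⟨b₀, hb⟩ := hdec b
    obtain ⟨c, hac, hbc⟩ := exists_ge_ge a₀ b₀
    exact ⟨c, ha c hac, hb c hbc⟩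
  · rintro _ ⟨α, rfl⟩
    exact abs_nonneg _
  · rw [← hι.map_le_map_iff, map_zero]
    refine hglb.2 ?_
    rintro _ ⟨β, rfl⟩
    obtain ⟨α₀, hα₀⟩ := hy β
    -- Each `y β` dominates some distance, hence also `ι e`.
    refine le_trans ?_ (hα₀ α₀ le_rfl)
    rw [← map_sub, ← hι.map_abs, hι.map_le_map_iff]
    exact he ⟨α₀, rfl⟩

end Completion

/-- Along a laterally convergent net, each distance to the limit eventually dominates the others.
At a maximal index, which is then a greatest one, the distance vanishes from there on. -/
theorem LaterallyConverges.eventually_abs_sub_le {E : Type*} [AddCommGroup E] [Lattice E]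
    [IsOrderedAddMonoid E] {A : Type*} [Preorder A] [IsDirectedOrder A] {x : A → E} {l : E}
    (h : LaterallyConverges x l) (α : A) :
    ∃ α₀, ∀ α', α₀ ≤ α' → |x α' - l| ≤ |x α - l| := by
  obtain ⟨hfrag, B, _, _, _, y, -, hglb, hy⟩ := h
  by_cases hα : IsMax α
  -- No index lies strictly above `α`, so fragments say nothing; but every `α₀` is below `α'`, so
  -- all `y β` bound this distance.
  · refine ⟨α, fun α' hα' => le_trans (hglb.2 ?_) (abs_nonneg _)⟩
    rintro _ ⟨β, rfl⟩
    obtain ⟨α₀, hα₀⟩ := hy β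
    exact hα₀ α' ((hα.isTop α₀).trans hα')
  · obtain ⟨γ, hγ⟩ := not_isMax_iff.1 hα
    exact ⟨γ, fun α' hα' =>
      (hfrag α α' (hγ.trans_le hα')).1.abs_sub_le_abs_sub (hfrag α α' (hγ.trans_le hα')).2⟩

end RieszSpace

theorem theorem2p4 {E : Type*} {F : Type*}
    [AddCommGroup E] [Lattice E] [IsOrderedAddMonoid E] [Module ℝ E] [IsOrderedModule ℝ E]
    [AddCommGroup F] [Lattice F] [IsOrderedAddMonoid F] [Module ℝ F] [IsOrderedModule ℝ F]
    (ι : E →ₗ[ℝ] F) (hι : RieszSpace.IsDedekindCompletion ι)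
    {A : Type*} [Preorder A] [IsDirectedOrder A] [Nonempty A] (x : A → E) (l : E) :
    RieszSpace.LaterallyConverges x l ↔
      RieszSpace.LaterallyConverges (fun α => ι (x α)) (ι l) := by
  refine ⟨fun h => ⟨?_, h.2.map hι⟩, fun h => ⟨?_, .of_map hι (fun α => ?_) h.2⟩⟩
  · simpa only [hι.isFragment_map_iff] using h.1
  · simpa only [hι.isFragment_map_iff] using h.1
  · obtain ⟨α₀, hα₀⟩ := h.eventually_abs_sub_le α
    refine ⟨α₀, fun α' hα' => ?_⟩
    rw [← hι.map_le_map_iff, hι.map_abs, hι.map_abs, map_sub, map_sub]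
    exact hα₀ α' hα'
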